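/- Let $X$ be a complete metric space and $m\ge 0$. Let $\mathrm{Lip}(X)$ and $\mathrm{Lip}_b(X)$ be the spaces of real-valued Lipschitz, respectively bounded Lipschitz, functions on $X$, and let $\mathrm{Lip}(\pi)$ denote the (global) Lipschitz constant of $\pi$. A metric $m$-current on $X$ is a multilinear functional $T:\mathrm{Lip}_b(X)\times \mathrm{Lip}(X)^m\to\mathbb R$ such that: (i) $T(f,\pi^j_1,\dots,\pi^j_m)\to T(f,\pi_1,\dots,\pi_m)$ whenever $\pi_i^j\to\pi_i$ pointwise as $j\to\infty$ for each $i$ and $\sup_{i,j}\mathrm{Lip}(\pi_i^j)<\infty$; (ii) $T(f,\pi_1,\dots,\pi_m)=0$ whenever $\{f\neq 0\}\subset\bigcup_{i=1}^m B_i$ with Borel sets $B_i$ such that $\pi_i$ is constant on $B_i$; (iii) there is a finite Borel measure $\mu$ on $X$ with $|T(f,\pi_1,\dots,\pi_m)|\le\prod_{i=1}^m\mathrm{Lip}(\pi_i)\int_X|f|\,d\mu$ for all $(f,\pi_1,\dots,\pi_m)$. The minimal measure $\mu$ in (iii) is denoted $\|T\|$, and $\mathbf M_m(X)$ is the additive group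 of metric $m$-currents. The boundary of $S\in\mathbf M_{m+1}(X)$ is the functional $\partial S(f,\pi_1,\dots,\pi_m)=S(1,f,\pi_1,\dots,\pi_m)$. A cochain on an additive subgroup $\mathcal C$ of $\mathbf M_m(X)$ is a function $\omega:\mathcal C\to[-\infty,\infty]$ with $\omega(0)=0$ and $|\omega(T)|\le|\omega(T+S)|+|\omega(S)|$ for all $T,S\in\mathcal C$. A Borel function $h:X\to[0,\infty]$ is an upper norm of $\omega$ if $|\omega(T)|\le\int_X h\,d\|T\|$ for all $T\in\mathcal C$. A Borel function $g:X\to[0,\infty]$ is an upper gradient of $\omega$ with respect to a set $\mathcal C'\subset\mathbf M_{m+1}(X)$ if $|\omega(T)|\le\int_X g\,d\|S\|$ for all $T\in\mathcal C$ and $S\in\mathcal C'$ with $\partial S=T$. For a Lipschitz function $u$ on $X$, its pointwise upper Lipschitz constant at $x$ is $$\operatorname{Lip}u(x)=\lim_{r\to0^+}\ \sup_{0<s<r}\ \sup_{d(x,y)<s}\frac{|u(x)-u(y)|}{s}.$$ **Proposition.** Let $(f,\pi_1,\dots,\pi_m)\in\mathrm{Lip}_b(X)\times\mathrm{Lip}(X)^m$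 and let $\omega$ be the cochain on $\mathbf M_m(X)$ given by $\omega(T)=T(f,\pi_1,\dots,\pi_m)$. Then $$h(x)=|f(x)|\prod_{i=1}^m\operatorname{Lip}\pi_i(x)$$ is an upper norm of $\omega$, and $$g(x)=\operatorname{Lip}f(x)\prod_{i=1}^m\operatorname{Lip}\pi_i(x)$$ is an upper gradient of $\omega$ with respect to $\mathbf M_{m+1}(X)$, where for $m=0$ the empty products equal $1$. -/

import Mathlib

open Set Filter Topology MeasureTheory
open scoped NNReal ENNReal

namespace MetricCurrents

universe u

section Lipschitz

variable (X : Type u) [MetricSpace X]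

/-- The vector space `Lip(X)` of real-valued Lipschitz functions on `X`. -/
def Lip : Submodule ℝ (X → ℝ) where
  carrier := {f | ∃ K : ℝ≥0, LipschitzWith K f}
  zero_mem' := ⟨0, LipschitzWith.const (0 : ℝ)⟩
  add_mem' := by
    rintro f g ⟨K, hK⟩ ⟨L, hL⟩
    exact ⟨K + L, hK.add hL⟩
  smul_mem' := by
    rintro c f ⟨K, hK⟩
    exact ⟨‖c‖₊ * K, (lipschitzWith_smul c).comp hK⟩

/-- The vector space `Lip_b(X)` of bounded real-valued Lipschitz functions on `X`. -/
def LipB : Submodule ℝ (X → ℝ) where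
  carrier := {f | f ∈ Lip X ∧ ∃ C : ℝ, ∀ x, |f x| ≤ C}
  zero_mem' := ⟨(Lip X).zero_mem, 0, fun x => by simp⟩
  add_mem' := by
    rintro f g ⟨hf, C, hC⟩ ⟨hg, D, hD⟩
    exact ⟨(Lip X).add_mem hf hg, C + D,
      fun x => (abs_add_le _ _).trans (add_le_add (hC x) (hD x))⟩
  smul_mem' := by
    rintro c f ⟨hf, C, hC⟩
    refine ⟨(Lip X).smul_mem c hf, |c| * C, fun x => ?_⟩
    rw [Pi.smul_apply, smul_eq_mul, abs_mul]
    exact mul_le_mul_of_nonneg_left (hC x) (abs_nonneg c)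

/-- The constant function `1` as a bounded Lipschitz function. -/
def LipB.one : LipB X :=
  ⟨fun _ => 1, ⟨0, LipschitzWith.const (1 : ℝ)⟩, 1, fun _ => by simp⟩

/-- The inclusion of `Lip_b(X)` into `Lip(X)`. -/
def LipB.toLip : LipB X →ₗ[ℝ] Lip X :=
  Submodule.inclusion fun _ hf => hf.1

variable {X}

/-- The Lipschitz constant `Lip(f)`: the least `K ≥ 0` such that `f` is `K`-Lipschitz. -/
noncomputable def lipConst (f : X → ℝ) : ℝ≥0 := sInf {K : ℝ≥0 | LipschitzWith K f}

/-- `L_r f(x) = sup_{0 < s < r} sup_{d(x,y) < s} |f(x) - f(y)| / s`. -/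
noncomputable def lipAtScale (f : X → ℝ) (r : ℝ) (x : X) : ℝ≥0∞ :=
  ⨆ s ∈ Ioo (0 : ℝ) r, ⨆ y ∈ Metric.ball x s, ‖f x - f y‖ₑ / ENNReal.ofReal s

/-- The pointwise upper Lipschitz constant of `f` at `x`, i.e. the limit of `L_r f(x)` as `r → 0+`.
Since `L_r f(x)` is nondecreasing in `r`, this limit is the infimum over `r > 0`
(see `tendsto_lipAtScale`). -/
noncomputable def ptLip (f : X → ℝ) (x : X) : ℝ≥0∞ := ⨅ r ∈ Ioi (0 : ℝ), lipAtScale f r x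

theorem tendsto_lipAtScale (f : X → ℝ) (x : X) :
    Tendsto (fun r : ℝ => lipAtScale f r x) (𝓝[>] 0) (𝓝 (ptLip f x)) := by
  have hmono : Monotone fun r : ℝ => lipAtScale f r x := fun r r' h =>
    iSup₂_mono' fun s hs => ⟨s, ⟨hs.1, hs.2.trans_le h⟩, le_rfl⟩
  have := hmono.tendsto_nhdsGT (0 : ℝ)
  rwa [sInf_image] at this

end Lipschitz

section Currents

variable (X : Type u) [MetricSpace X] (m : ℕ)

/-- Multilinear functionals `(f, π₁, …, πₘ) ↦ T(f, π₁, …, πₘ)` on `Lip_b(X) × Lip(X)^m`. -/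
abbrev Functional : Type u :=
  LipB X →ₗ[ℝ] MultilinearMap ℝ (fun _ : Fin m => Lip X) ℝ

variable {X m}

/-- The continuity property. -/
def IsContinuousFunctional (T : Functional X m) : Prop :=
  ∀ (f : LipB X) (π : Fin m → Lip X) (πs : ℕ → Fin m → Lip X),
    (∃ C : ℝ≥0, ∀ j i, lipConst (πs j i : X → ℝ) ≤ C) →
    (∀ i x, Tendsto (fun j => (πs j i : X → ℝ) x) atTop (𝓝 ((π i : X → ℝ) x))) →
    Tendsto (fun j => T f (πs j)) atTop (𝓝 (T f π))

/-- The boundary `∂T(f, π₁, …, πₘ) = T(1, f, π₁, …, πₘ)` of an `(m+1)`-dimensional functional. -/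
def boundary (T : Functional X (m + 1)) : Functional X m :=
  (T (LipB.one X)).curryLeft ∘ₗ LipB.toLip X

theorem boundary_apply (T : Functional X (m + 1)) (f : LipB X) (π : Fin m → Lip X) :
    boundary T f π = T (LipB.one X) (Fin.cons (LipB.toLip X f) π) := rfl

variable [MeasurableSpace X]

/-- The locality property. -/
def IsLocalFunctional (T : Functional X m) : Prop :=
  ∀ (f : LipB X) (π : Fin m → Lip X) (B : Fin m → Set X),
    (∀ i, MeasurableSet (B i)) →
    {x | (f : X → ℝ) x ≠ 0} ⊆ ⋃ i, B i →
    (∀ i, ∃ c : ℝ, ∀ x ∈ B i, (π i : X → ℝ) x = c) →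
    T f π = 0

/-- `μ` satisfies `|T(f, π₁, …, πₘ)| ≤ ∏ Lip(πᵢ) ∫ |f| dμ` for all `(f, π)`. -/
def IsMassBound (T : Functional X m) (μ : Measure X) : Prop :=
  ∀ (f : LipB X) (π : Fin m → Lip X),
    ‖T f π‖ₑ ≤ (∏ i, (lipConst (π i : X → ℝ) : ℝ≥0∞)) * ∫⁻ x, ‖(f : X → ℝ) x‖ₑ ∂μ

/-- Metric `m`-currents in the sense of Ambrosio and Kirchheim. -/
structure IsMetricCurrent (T : Functional X m) : Prop where
  continuity : IsContinuousFunctional T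
  locality : IsLocalFunctional T
  finite_mass : ∃ μ : Measure X, IsFiniteMeasure μ ∧ IsMassBound T μ

variable (X m) in
/-- The additive group `𝐌ₘ(X)` of all metric `m`-currents on `X`. -/
def Current : AddSubgroup (Functional X m) where
  carrier := {T | IsMetricCurrent T}
  zero_mem' :=
    { continuity := fun f π πs _ _ => by simp
      locality := fun f π B _ _ _ => by simp
      finite_mass := ⟨0, inferInstance, fun f π => by simp⟩ }
  add_mem' := by
    intro T S hT hS
    obtain ⟨μ, hμ, hTμ⟩ := hT.finite_mass
    obtain ⟨ν, hν, hSν⟩ := hS.finite_mass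
    refine ⟨fun f π πs hb hp => ?_, fun f π B hB hf hc => ?_, μ + ν, inferInstance, fun f π => ?_⟩
    · exact (hT.continuity f π πs hb hp).add (hS.continuity f π πs hb hp)
    · rw [LinearMap.add_apply, add_apply, hT.locality f π B hB hf hc,
        hS.locality f π B hB hf hc, add_zero]
    · rw [LinearMap.add_apply, add_apply, lintegral_add_measure, mul_add]
      exact (enorm_add_le _ _).trans (add_le_add (hTμ f π) (hSν f π))
  neg_mem' := by
    intro T hT
    obtain ⟨μ, hμ, hTμ⟩ := hT.finite_mass
    refine ⟨fun f π πs hb hp => ?_, fun f π B hB hf hc => ?_, μ, inferInstance, fun f π => ?_⟩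
    · exact (hT.continuity f π πs hb hp).neg
    · change -(T f π) = 0
      rw [hT.locality f π B hB hf hc, neg_zero]
    · change ‖-(T f π)‖ₑ ≤ _
      rw [enorm_neg]
      exact hTμ f π

/-- The mass measure `‖T‖`: the smallest finite Borel measure `μ` with
`|T(f, π₁, …, πₘ)| ≤ ∏ Lip(πᵢ) ∫ |f| dμ`, written as an infimum in the lattice of measures. -/
noncomputable def mass (T : Functional X m) : Measure X :=
  sInf {μ : Measure X | IsFiniteMeasure μ ∧ IsMassBound T μ}

/-- A cochain on an additive subgroup `𝒞` of the group of metric `m`-currents: a function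
`ω : 𝒞 → [-∞, ∞]` with `ω(0) = 0` and `|ω(T)| ≤ |ω(T + S)| + |ω(S)|`. -/
structure Cochain (𝒞 : AddSubgroup (Current X m)) where
  toFun : 𝒞 → EReal
  map_zero : toFun 0 = 0
  sublinear : ∀ T S : 𝒞, (toFun T).abs ≤ (toFun (T + S)).abs + (toFun S).abs

/-- A Borel function `h : X → [0, ∞]` is an upper norm of the cochain `ω` on `𝒞` if
`|ω(T)| ≤ ∫ h d‖T‖` for all `T ∈ 𝒞`. -/
structure IsUpperNorm {𝒞 : AddSubgroup (Current X m)} (ω : Cochain 𝒞) (h : X → ℝ≥0∞) : Prop where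
  measurable : Measurable h
  le : ∀ T : 𝒞, (ω.toFun T).abs ≤ ∫⁻ x, h x ∂(mass (T : Current X m).1)

/-- A Borel function `g : X → [0, ∞]` is an upper gradient of the cochain `ω` on `𝒞` with respect
to a set `𝒞'` of metric `(m+1)`-currents if `|ω(T)| ≤ ∫ g d‖S‖` for all `T ∈ 𝒞` and `S ∈ 𝒞'` such
that `∂S = T`. -/
structure IsUpperGradient {𝒞 : AddSubgroup (Current X m)} (ω : Cochain 𝒞)
    (𝒞' : Set (Current X (m + 1))) (g : X → ℝ≥0∞) : Prop where
  measurable : Measurable g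
  le : ∀ T : 𝒞, ∀ S ∈ 𝒞', boundary S.1 = (T : Current X m).1 →
    (ω.toFun T).abs ≤ ∫⁻ x, g x ∂(mass S.1)

/-- The cochain `ω(T) = T(f, π₁, …, πₘ)` on the group of all metric `m`-currents. -/
def formCochain (f : LipB X) (π : Fin m → Lip X) :
    Cochain (⊤ : AddSubgroup (Current X m)) where
  toFun T := (((T : Current X m).1 f π : ℝ) : EReal)
  map_zero := by simp
  sublinear := by
    intro T S
    have h : ((T + S : (⊤ : AddSubgroup (Current X m))) : Current X m).1 f π
        = (T : Current X m).1 f π + (S : Current X m).1 f π := rfl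
    rw [h]
    simp only [EReal.abs_def, ← ENNReal.ofReal_add (abs_nonneg _) (abs_nonneg _)]
    refine ENNReal.ofReal_le_ofReal ?_
    have := abs_sub ((T : Current X m).1 f π + (S : Current X m).1 f π) ((S : Current X m).1 f π)
    rwa [add_sub_cancel_right] at this

end Currents

end MetricCurrents

/-!
The upper gradient inequality for `ω` is the upper norm inequality applied to `S` and the form
`(1, f, π₁, …, πₘ)`, because `∂S(f, π) = S(1, f, π)`. So everything rests on the estimate
`|T(f, π)| ≤ ∫ |f| ∏ Lip πᵢ(x) d‖T‖(x)` for a metric current `T`, the mass bound with pointwise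
instead of global Lipschitz constants (`Current.abs_apply_le`).

* Near a closed set `K`, the value `T(f, π)` depends only on the restrictions `πᵢ|K`
  (`IsMetricCurrent.tendsto_apply_cut_sub`). Here "near `K`" means that `f` is multiplied by
  Lipschitz cutoffs decreasing to the indicator of `K`. If `πᵢ|K` is `Lᵢ`-Lipschitz, it can thus be
  exchanged for an `Lᵢ`-Lipschitz extension, and the mass bound holds near `K` with the constant
  `∏ Lᵢ` (`IsMetricCurrent.exists_tendsto_enorm_apply_cut_le`).
* For each `ε > 0` there is a countable Borel partition of `X` such that each `πᵢ` is
  `Lᵢ`-Lipschitz on each piece, where `Lᵢ ≤ Lip πᵢ(x) + ε` at all points `x` of the piece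
  (`exists_partition_lipschitzOnWith`). The pieces are cut out by the values of the `πᵢ`, not by
  small balls, so neither separability of `X` nor tightness of `‖T‖` is used.
* Bounds near closed subsets of the pieces of a countable partition add up
  (`enorm_le_tsum_of_forall_cut`). Letting `ε → 0` gives the estimate for any finite measure that
  is a mass bound.

The gluing lemma also shows that `‖T‖`, defined as an infimum in the lattice of measures, is a mass
bound itself (`IsMetricCurrent.isMassBound_mass`). The infimum of a family of measures is obtained
by distributing the pieces of countable partitions among the members of the family, and mass bounds
distributed in this way are again mass bounds.
-/

namespace MetricCurrents

theorem tendsto_lintegral_enorm {X : Type*} [MeasurableSpace X] {μ : Measure X}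
    [IsFiniteMeasure μ] {g : ℕ → X → ℝ} {g₀ : X → ℝ}
    (hg : ∀ n, Measurable (g n)) (M : ℝ) (hM : ∀ n x, |g n x| ≤ M)
    (hlim : ∀ x, Tendsto (fun n => g n x) atTop (𝓝 (g₀ x))) :
    Tendsto (fun n => ∫⁻ x, ‖g n x‖ₑ ∂μ) atTop (𝓝 (∫⁻ x, ‖g₀ x‖ₑ ∂μ)) := by
  refine tendsto_lintegral_of_dominated_convergence (fun _ => ENNReal.ofReal M)
    (fun n => (hg n).enorm) (fun n => ae_of_all _ fun x => ?_) ?_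
    (ae_of_all _ fun x => (hlim x).enorm)
  · exact (Real.enorm_eq_ofReal_abs _).trans_le (ENNReal.ofReal_le_ofReal (hM n x))
  · rw [lintegral_const]
    exact ENNReal.mul_ne_top ENNReal.ofReal_ne_top (measure_ne_top _ _)

section Cutoff

variable {X : Type*} [MetricSpace X]

/-! ### Lipschitz constants -/

theorem lipschitzWith_lipConst {f : X → ℝ} (hf : f ∈ Lip X) : LipschitzWith (lipConst f) f := by
  have hne : {K : ℝ≥0 | LipschitzWith K f}.Nonempty := hf
  refine LipschitzWith.of_dist_le_mul fun x y => ?_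
  rcases (dist_nonneg (x := x) (y := y)).eq_or_lt with h | h
  · have : x = y := dist_eq_zero.1 h.symm
    simp [this]
  · rw [← div_le_iff₀ h]
    have h0 : 0 ≤ dist (f x) (f y) / dist x y := by positivity
    lift dist (f x) (f y) / dist x y to ℝ≥0 using h0 with q hq
    refine NNReal.coe_le_coe.2 (le_csInf hne fun K hK => ?_)
    rw [← NNReal.coe_le_coe, hq, div_le_iff₀ h]
    exact hK.dist_le_mul x y

theorem lipConst_le {f : X → ℝ} {K : ℝ≥0} (hf : LipschitzWith K f) : lipConst f ≤ K :=
  csInf_le (OrderBot.bddBelow _) hf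

theorem Lip.continuous (f : Lip X) : Continuous (f : X → ℝ) :=
  (lipschitzWith_lipConst f.2).continuous

theorem LipB.continuous (f : LipB X) : Continuous (f : X → ℝ) :=
  (lipschitzWith_lipConst f.2.1).continuous

/-! ### Cutting off near a closed set -/

/-- A Lipschitz cutoff function with values in `[0, 1]`, equal to `1` on `K` and to `0` at
distance at least `1 / (n + 1)` from `K`. It vanishes identically when `K` is empty. -/
noncomputable def cutoff (K : Set X) (n : ℕ) (x : X) : ℝ :=
  thickenedIndicator (Nat.one_div_pos_of_nat (α := ℝ) (n := n)) K x

theorem cutoff_nonneg (K : Set X) (n : ℕ) (x : X) : 0 ≤ cutoff K n x := NNReal.coe_nonneg _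

theorem cutoff_le_one (K : Set X) (n : ℕ) (x : X) : cutoff K n x ≤ 1 :=
  NNReal.coe_le_coe.2 (thickenedIndicator_le_one _ K x)

theorem lipschitzWith_cutoff (K : Set X) (n : ℕ) :
    LipschitzWith (1 / ((n : ℝ) + 1)).toNNReal⁻¹ (cutoff K n) :=
  lipschitzWith_thickenedIndicator (Nat.one_div_pos_of_nat (α := ℝ) (n := n)) K

theorem tendsto_cutoff {K : Set X} (hK : IsClosed K) (x : X) :
    Tendsto (fun n => cutoff K n x) atTop (𝓝 (K.indicator (fun _ => (1 : ℝ)) x)) := by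
  have h := tendsto_pi_nhds.1 (thickenedIndicator_tendsto_indicator_closure
    (fun n => Nat.one_div_pos_of_nat (α := ℝ) (n := n)) tendsto_one_div_add_atTop_nhds_zero_nat K) x
  have h' := (NNReal.continuous_coe.tendsto _).comp h
  rw [hK.closure_eq] at h'
  have hx : ((K.indicator (fun _ => (1 : ℝ≥0)) x : ℝ≥0) : ℝ) = K.indicator (fun _ => 1) x := by
    by_cases hx : x ∈ K <;> simp [hx]
  rwa [hx] at h'

/-- The product of a bounded Lipschitz function with the `n`-th cutoff function of `K`. -/
noncomputable def cut (f : LipB X) (K : Set X) (n : ℕ) : LipB X :=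
  ⟨fun x => (f : X → ℝ) x * cutoff K n x, by
    obtain ⟨C, hC⟩ := f.2.2
    refine ⟨⟨lipConst (f : X → ℝ) + C.toNNReal * (1 / ((n : ℝ) + 1)).toNNReal⁻¹,
      LipschitzWith.of_dist_le_mul fun x y => ?_⟩, C, fun x => ?_⟩
    · have h1 := (lipschitzWith_lipConst f.2.1).dist_le_mul x y
      have h2 := (lipschitzWith_cutoff K n).dist_le_mul x y
      rw [Real.dist_eq] at h1 h2 ⊢
      have hC' : |(f : X → ℝ) y| ≤ (C.toNNReal : ℝ) := (hC y).trans (Real.le_coe_toNNReal C)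
      calc |(f : X → ℝ) x * cutoff K n x - (f : X → ℝ) y * cutoff K n y|
          = |((f : X → ℝ) x - (f : X → ℝ) y) * cutoff K n x
              + (f : X → ℝ) y * (cutoff K n x - cutoff K n y)| := by ring_nf
        _ ≤ |(f : X → ℝ) x - (f : X → ℝ) y| * |cutoff K n x|
              + |(f : X → ℝ) y| * |cutoff K n x - cutoff K n y| := by
            rw [← abs_mul, ← abs_mul]; exact abs_add_le _ _
        _ ≤ (lipConst (f : X → ℝ) * dist x y) * 1
              + C.toNNReal * ((1 / ((n : ℝ) + 1)).toNNReal⁻¹ * dist x y) := by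
            rw [abs_of_nonneg (cutoff_nonneg K n x)]
            gcongr
            exacts [cutoff_nonneg K n x, cutoff_le_one K n x]
        _ = _ := by push_cast; ring
    · rw [abs_mul, abs_of_nonneg (cutoff_nonneg K n x)]
      exact (mul_le_of_le_one_right (abs_nonneg _) (cutoff_le_one K n x)).trans (hC x)⟩

theorem cut_apply (f : LipB X) (K : Set X) (n : ℕ) (x : X) :
    (cut f K n : X → ℝ) x = (f : X → ℝ) x * cutoff K n x := rfl

theorem abs_cut_le (f : LipB X) (K : Set X) (n : ℕ) (x : X) :
    |(cut f K n : X → ℝ) x| ≤ |(f : X → ℝ) x| := by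
  rw [cut_apply, abs_mul, abs_of_nonneg (cutoff_nonneg K n x)]
  exact mul_le_of_le_one_right (abs_nonneg _) (cutoff_le_one K n x)

theorem tendsto_cut (f : LipB X) {K : Set X} (hK : IsClosed K) (x : X) :
    Tendsto (fun n => (cut f K n : X → ℝ) x) atTop (𝓝 (K.indicator (f : X → ℝ) x)) := by
  have h := (tendsto_cutoff hK x).const_mul ((f : X → ℝ) x)
  rwa [← indicator_mul_right K (f : X → ℝ), funext fun y => mul_one ((f : X → ℝ) y)] at h

variable [MeasurableSpace X] [BorelSpace X]

theorem LipB.measurable (f : LipB X) : Measurable (f : X → ℝ) := (LipB.continuous f).measurable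

theorem tendsto_lintegral_cut (f : LipB X) {K : Set X} (hK : IsClosed K) (μ : Measure X)
    [IsFiniteMeasure μ] :
    Tendsto (fun n => ∫⁻ x, ‖(cut f K n : X → ℝ) x‖ₑ ∂μ) atTop
      (𝓝 (∫⁻ x in K, ‖(f : X → ℝ) x‖ₑ ∂μ)) := by
  obtain ⟨M, hM⟩ := f.2.2
  have h := tendsto_lintegral_enorm (μ := μ) (fun n => (LipB.measurable (cut f K n))) M
    (fun n x => (abs_cut_le f K n x).trans (hM x)) (tendsto_cut f hK)
  convert h using 2
  rw [← lintegral_indicator hK.measurableSet]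
  refine lintegral_congr fun x => ?_
  by_cases hx : x ∈ K <;> simp [hx]

/-- The cutoffs of `f` approach the restriction of `f` to `K` in `L¹`. -/
theorem tendsto_lintegral_cut_sub_indicator (f : LipB X) {K : Set X} (hK : IsClosed K)
    (μ : Measure X) [IsFiniteMeasure μ] :
    Tendsto (fun n => ∫⁻ x, ‖(cut f K n : X → ℝ) x - K.indicator (f : X → ℝ) x‖ₑ ∂μ) atTop
      (𝓝 0) := by
  obtain ⟨M, hM⟩ := f.2.2
  have h := tendsto_lintegral_enorm (μ := μ)
    (g := fun n x => (cut f K n : X → ℝ) x - K.indicator (f : X → ℝ) x) (g₀ := fun _ => 0)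
    (fun n => (LipB.measurable (cut f K n)).sub ((LipB.measurable f).indicator hK.measurableSet)) (M + M)
    (fun n x => ?_) (fun x => ?_)
  · simpa using h
  · refine (abs_sub _ _).trans (add_le_add ((abs_cut_le f K n x).trans (hM x)) ?_)
    by_cases hx : x ∈ K
    · simpa [hx] using hM x
    · simpa [hx] using (abs_nonneg _).trans (hM x)
  · simpa using (tendsto_cut f hK x).sub_const (K.indicator (f : X → ℝ) x)

/-! ### Gluing local bounds -/

/-- If `Φ` is bounded in `L¹(μ)`, then bounds by `νₖ` near closed subsets of the pieces `Bₖ` of a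
countable Borel partition add up. The pieces are exhausted from inside by closed sets up to small
`μ`-measure, and the cutoffs near finitely many of these closed sets recover `f` up to an error that
is small in `L¹(μ)`. -/
theorem enorm_le_tsum_of_forall_cut (Φ : LipB X →ₗ[ℝ] ℝ) (μ : Measure X) [IsFiniteMeasure μ]
    (C : ℝ≥0) (hΦ : ∀ g : LipB X, ‖Φ g‖ₑ ≤ C * ∫⁻ x, ‖(g : X → ℝ) x‖ₑ ∂μ) (f : LipB X)
    {B : ℕ → Set X} (hB : ∀ k, MeasurableSet (B k)) (hdisj : Pairwise (Function.onFun Disjoint B))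
    (hcover : ⋃ k, B k = univ) (ν : ℕ → Measure X)
    (hloc : ∀ k K, IsClosed K → K ⊆ B k → ∃ u : ℕ → ℝ≥0∞,
      Tendsto u atTop (𝓝 (∫⁻ x in K, ‖(f : X → ℝ) x‖ₑ ∂ν k)) ∧ ∀ n, ‖Φ (cut f K n)‖ₑ ≤ u n) :
    ‖Φ f‖ₑ ≤ ∑' k, ∫⁻ x in B k, ‖(f : X → ℝ) x‖ₑ ∂ν k := by
  obtain ⟨M, hM⟩ := f.2.2
  have hM' : ∀ x, ‖(f : X → ℝ) x‖ₑ ≤ ENNReal.ofReal M := fun x => by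
    rw [Real.enorm_eq_ofReal_abs]; exact ENNReal.ofReal_le_ofReal (hM x)
  suffices H : ∀ ε : ℝ≥0∞, ε ≠ 0 →
      ‖Φ f‖ₑ ≤ ∑' k, ∫⁻ x in B k, ‖(f : X → ℝ) x‖ₑ ∂ν k + C * (ENNReal.ofReal M * ε) by
    have h0 : Tendsto (fun n : ℕ => ∑' k, ∫⁻ x in B k, ‖(f : X → ℝ) x‖ₑ ∂ν k
        + C * (ENNReal.ofReal M * (n : ℝ≥0∞)⁻¹)) atTop
        (𝓝 (∑' k, ∫⁻ x in B k, ‖(f : X → ℝ) x‖ₑ ∂ν k + C * (ENNReal.ofReal M * 0))) :=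
      tendsto_const_nhds.add (ENNReal.Tendsto.const_mul (ENNReal.Tendsto.const_mul
        ENNReal.tendsto_inv_nat_nhds_zero (.inr ENNReal.ofReal_ne_top)) (.inr ENNReal.coe_ne_top))
    rw [mul_zero, mul_zero, add_zero] at h0
    exact ge_of_tendsto' h0 fun n => H _ (ENNReal.inv_ne_zero.2 (ENNReal.natCast_ne_top n))
  intro ε hε
  obtain ⟨δ, hδ, hδε⟩ := ENNReal.exists_pos_sum_of_countable' hε ℕ
  choose K hKB hKc hKδ using fun k =>
    (hB k).exists_isClosed_sdiff_lt (measure_ne_top μ (B k)) (hδ k).ne'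
  choose u hu hΦu using fun k => hloc k (K k) (hKc k) (hKB k)
  -- After finitely many pieces, the error is the integral of `|f|` off the chosen closed sets.
  have hfin : ∀ N : ℕ, ‖Φ f‖ₑ ≤ ∑' k, ∫⁻ x in B k, ‖(f : X → ℝ) x‖ₑ ∂ν k
      + C * ∫⁻ x, ‖((⋃ k < N, K k)ᶜ).indicator (f : X → ℝ) x‖ₑ ∂μ := by
    intro N
    let r : ℕ → LipB X := fun n => f - ∑ k ∈ Finset.range N, cut f (K k) n
    have hr : ∀ n x, (r n : X → ℝ) x
        = (f : X → ℝ) x - ∑ k ∈ Finset.range N, (cut f (K k) n : X → ℝ) x := by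
      intro n x
      simp [r]
    have hlim : ∀ x, Tendsto (fun n => (r n : X → ℝ) x) atTop
        (𝓝 (((⋃ k < N, K k)ᶜ).indicator (f : X → ℝ) x)) := by
      intro x
      have h := (tendsto_finsetSum (Finset.range N)
        fun k _ => tendsto_cut f (hKc k) x).const_sub ((f : X → ℝ) x)
      simp only [hr]
      convert h using 2
      by_cases hx : ∃ k < N, x ∈ K k
      · obtain ⟨j, hj, hxj⟩ := hx
        rw [indicator_of_notMem (by simpa using ⟨j, hj, hxj⟩),
          Finset.sum_eq_single_of_mem j (Finset.mem_range.2 hj), indicator_of_mem hxj, sub_self]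
        intro k _ hkj
        refine indicator_of_notMem (fun hxk => ?_) _
        exact (hdisj hkj).le_bot ⟨hKB k hxk, hKB j hxj⟩
      · rw [indicator_of_mem (by simpa using hx), Finset.sum_eq_zero, sub_zero]
        exact fun k hk => indicator_of_notMem
          (fun hxk => hx ⟨k, Finset.mem_range.1 hk, hxk⟩) _
    have hrint := tendsto_lintegral_enorm (μ := μ) (fun n => LipB.measurable (r n))
      (M + ∑ k ∈ Finset.range N, M) (fun n x => by
        rw [hr]
        refine (abs_sub _ _).trans (add_le_add (hM x) ((Finset.abs_sum_le_sum_abs _ _).trans ?_))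
        exact Finset.sum_le_sum fun k _ => (abs_cut_le f _ _ _).trans (hM x)) hlim
    have hsum := tendsto_finsetSum (Finset.range N) fun k _ => hu k
    have hle : ‖Φ f‖ₑ ≤ ∑ k ∈ Finset.range N, ∫⁻ x in K k, ‖(f : X → ℝ) x‖ₑ ∂ν k
        + C * ∫⁻ x, ‖((⋃ k < N, K k)ᶜ).indicator (f : X → ℝ) x‖ₑ ∂μ := by
      refine ge_of_tendsto' (hsum.add (ENNReal.Tendsto.const_mul hrint
        (.inr ENNReal.coe_ne_top))) fun n => ?_
      have hdec : Φ f = ∑ k ∈ Finset.range N, Φ (cut f (K k) n) + Φ (r n) := by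
        simp [r, map_sub]
      rw [hdec]
      refine (enorm_add_le _ _).trans (add_le_add ((enorm_sum_le _ _).trans ?_) (hΦ _))
      exact Finset.sum_le_sum fun k _ => hΦu k n
    refine hle.trans (add_le_add_left ?_ _)
    exact (Finset.sum_le_sum fun k _ => lintegral_mono_set (hKB k)).trans (ENNReal.sum_le_tsum _)
  have htail : Tendsto (fun N => ∫⁻ x, ‖((⋃ k < N, K k)ᶜ).indicator (f : X → ℝ) x‖ₑ ∂μ) atTop
      (𝓝 (∫⁻ x, ‖((⋃ k, K k)ᶜ).indicator (f : X → ℝ) x‖ₑ ∂μ)) := by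
    refine tendsto_lintegral_enorm (fun N => (LipB.measurable f).indicator
      (MeasurableSet.biUnion (to_countable _) fun k _ => (hKc k).measurableSet).compl) M
      (fun N x => ?_) fun x => ?_
    · by_cases hx : x ∈ (⋃ k < N, K k)ᶜ
      · rw [indicator_of_mem hx]; exact hM x
      · rw [indicator_of_notMem hx, abs_zero]; exact (abs_nonneg _).trans (hM x)
    · refine tendsto_const_nhds.congr' ?_
      by_cases hx : ∃ k, x ∈ K k
      · obtain ⟨j, hxj⟩ := hx
        filter_upwards [eventually_gt_atTop j] with N hN
        rw [indicator_of_notMem (by simpa using ⟨j, hxj⟩),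
          indicator_of_notMem (by simpa using ⟨j, hN, hxj⟩)]
      · push Not at hx
        refine Eventually.of_forall fun N => ?_
        have h1 : x ∈ (⋃ k, K k)ᶜ := by simpa using hx
        have h2 : x ∈ (⋃ k < N, K k)ᶜ := by simpa using fun k _ => hx k
        simp only [indicator_of_mem h1, indicator_of_mem h2]
  refine (ge_of_tendsto' (tendsto_const_nhds.add (ENNReal.Tendsto.const_mul htail
    (.inr ENNReal.coe_ne_top))) hfin).trans ?_
  gcongr
  have hcompl : (⋃ k, K k)ᶜ ⊆ ⋃ k, B k \ K k := by
    intro x hx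
    obtain ⟨k, hk⟩ := mem_iUnion.1 (hcover ▸ mem_univ x : x ∈ ⋃ k, B k)
    exact mem_iUnion.2 ⟨k, hk, fun hxk => hx (mem_iUnion.2 ⟨k, hxk⟩)⟩
  calc ∫⁻ x, ‖((⋃ k, K k)ᶜ).indicator (f : X → ℝ) x‖ₑ ∂μ
      ≤ ∫⁻ x, ((⋃ k, K k)ᶜ).indicator (fun _ => ENNReal.ofReal M) x ∂μ := by
        refine lintegral_mono fun x => ?_
        by_cases hx : x ∈ (⋃ k, K k)ᶜ
        · rw [indicator_of_mem hx, indicator_of_mem hx]; exact hM' x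
        · rw [indicator_of_notMem hx, indicator_of_notMem hx, enorm_zero]
    _ ≤ ENNReal.ofReal M * μ ((⋃ k, K k)ᶜ) := lintegral_indicator_const_le _ _
    _ ≤ ENNReal.ofReal M * ε := by
        gcongr
        calc μ ((⋃ k, K k)ᶜ) ≤ ∑' k, μ (B k \ K k) :=
              (measure_mono hcompl).trans (measure_iUnion_le _)
          _ ≤ ∑' k, δ k := ENNReal.tsum_le_tsum fun k => (hKδ k).le
          _ ≤ ε := hδε.le

end Cutoff

/-! ### The mass measure -/

/-- The total mass of the infimum of a set of measures is approximated by distributing the pieces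
of a countable measurable partition among the members of the set. -/
theorem exists_partition_tsum_le_sInf {X : Type*} [MeasurableSpace X] {𝒮 : Set (Measure X)}
    (hne : 𝒮.Nonempty) (hfin : sInf 𝒮 univ ≠ ∞) {ε : ℝ≥0∞} (hε : ε ≠ 0) :
    ∃ (t : ℕ → Set X) (μ : ℕ → Measure X), (∀ k, MeasurableSet (t k)) ∧
      Pairwise (Function.onFun Disjoint t) ∧ ⋃ k, t k = univ ∧ (∀ k, μ k ∈ 𝒮) ∧
      ∑' k, μ k (t k) ≤ sInf 𝒮 univ + ε := by
  have hε2 : ε / 2 ≠ 0 := by simpa using hε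
  have h1 : sInf 𝒮 univ < sInf 𝒮 univ + ε / 2 := ENNReal.lt_add_right hfin hε2
  conv_lhs at h1 => rw [Measure.sInf_apply MeasurableSet.univ, OuterMeasure.sInf_apply (hne.image _)]
  simp only [iInf_lt_iff, iInf_image] at h1
  obtain ⟨s, hs, hlt⟩ := h1
  obtain ⟨δ, hδ, hδε⟩ := ENNReal.exists_pos_sum_of_countable' hε2 ℕ
  have h2 : ∀ k, ∃ μ ∈ 𝒮, μ (s k) ≤ (⨅ μ ∈ 𝒮, μ (s k)) + δ k := by
    intro k
    have hfink : (⨅ μ ∈ 𝒮, μ (s k)) ≠ ∞ :=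
      ne_top_of_le_ne_top hlt.ne_top (ENNReal.le_tsum (f := fun k => ⨅ μ ∈ 𝒮, μ (s k)) k)
    have h := ENNReal.lt_add_right hfink (hδ k).ne'
    conv_lhs at h => rw [iInf_subtype']
    obtain ⟨⟨μ, hμ⟩, hlt⟩ := iInf_lt_iff.1 h
    exact ⟨μ, hμ, hlt.le⟩
  choose μ hμ hμs using h2
  refine ⟨disjointed fun k => toMeasurable (μ k) (s k), μ,
    fun k => MeasurableSet.disjointed (fun k => measurableSet_toMeasurable _ _) k,
    disjoint_disjointed _, ?_, hμ, ?_⟩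
  · rw [iUnion_disjointed, ← univ_subset_iff]
    exact hs.trans (iUnion_mono fun k => subset_toMeasurable _ _)
  · calc ∑' k, μ k (disjointed (fun k => toMeasurable (μ k) (s k)) k)
        ≤ ∑' k, ((⨅ μ ∈ 𝒮, μ (s k)) + δ k) := ENNReal.tsum_le_tsum fun k => by
          refine (measure_mono (disjointed_subset _ k)).trans ?_
          rw [measure_toMeasurable]
          exact hμs k
      _ = ∑' k, (⨅ μ ∈ 𝒮, μ (s k)) + ∑' k, δ k := ENNReal.tsum_add
      _ ≤ (sInf 𝒮 univ + ε / 2) + ε / 2 := add_le_add hlt.le hδε.le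
      _ = _ := by rw [add_assoc, ENNReal.add_halves]

/-- Enlarging a finite measure by little mass changes the integral of a bounded function little. -/
theorem lintegral_le_lintegral_add {X : Type*} [MeasurableSpace X] {σ q : Measure X}
    [IsFiniteMeasure σ] (hσq : σ ≤ q) {ε : ℝ≥0∞} (hq : q univ ≤ σ univ + ε) {g : X → ℝ≥0∞}
    {M : ℝ≥0∞} (hg : ∀ x, g x ≤ M) : ∫⁻ x, g x ∂q ≤ ∫⁻ x, g x ∂σ + M * ε := by
  have hsub : q - σ + σ = q := Measure.sub_add_cancel_of_le hσq
  have hε : (q - σ) univ ≤ ε := by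
    rw [Measure.sub_apply MeasurableSet.univ hσq]
    exact tsub_le_iff_left.2 hq
  rw [← hsub, lintegral_add_measure, add_comm]
  gcongr
  calc ∫⁻ x, g x ∂(q - σ) ≤ ∫⁻ _, M ∂(q - σ) := lintegral_mono hg
    _ = M * (q - σ) univ := lintegral_const _
    _ ≤ M * ε := by gcongr

section Mass

variable {X : Type*} [MetricSpace X] {m : ℕ} [MeasurableSpace X]

/-- The linear functional `g ↦ T(g, π₁, …, πₘ)`. -/
def slice {X : Type*} [MetricSpace X] (T : Functional X m) (π : Fin m → Lip X) :
    LipB X →ₗ[ℝ] ℝ where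
  toFun g := T g π
  map_add' g g' := by simp
  map_smul' c g := by simp

theorem mass_le {T : Functional X m} {μ : Measure X} [IsFiniteMeasure μ] (hμ : IsMassBound T μ) :
    mass T ≤ μ :=
  sInf_le ⟨inferInstance, hμ⟩

theorem IsMetricCurrent.isFiniteMeasure_mass {T : Functional X m} (hT : IsMetricCurrent T) :
    IsFiniteMeasure (mass T) := by
  obtain ⟨μ, _, hμ⟩ := hT.finite_mass
  exact isFiniteMeasure_of_le μ (mass_le hμ)

variable [BorelSpace X]

/-- The mass measure is itself a mass bound: gluing the mass bounds of the members of a partition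
gives mass bounds whose total mass is arbitrarily close to that of the infimum. -/
theorem IsMetricCurrent.isMassBound_mass {T : Functional X m} (hT : IsMetricCurrent T) :
    IsMassBound T (mass T) := by
  intro f π
  have hσ := hT.isFiniteMeasure_mass
  obtain ⟨μ₀, hμ₀, hTμ₀⟩ := hT.finite_mass
  obtain ⟨M, hM⟩ := f.2.2
  set P : ℝ≥0 := ∏ i, lipConst (π i : X → ℝ) with hP
  have hPc : (∏ i, (lipConst (π i : X → ℝ) : ℝ≥0∞)) = P := by rw [hP]; push_cast; rfl
  rw [hPc]
  suffices H : ∀ ε : ℝ≥0∞, ε ≠ 0 → ‖T f π‖ₑ ≤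
      P * (∫⁻ x, ‖(f : X → ℝ) x‖ₑ ∂(mass T) + ENNReal.ofReal M * ε) by
    have h0 : Tendsto (fun n : ℕ => P * (∫⁻ x, ‖(f : X → ℝ) x‖ₑ ∂(mass T)
        + ENNReal.ofReal M * (n : ℝ≥0∞)⁻¹)) atTop
        (𝓝 (P * (∫⁻ x, ‖(f : X → ℝ) x‖ₑ ∂(mass T) + ENNReal.ofReal M * 0))) :=
      ENNReal.Tendsto.const_mul (tendsto_const_nhds.add (ENNReal.Tendsto.const_mul
        ENNReal.tendsto_inv_nat_nhds_zero (.inr ENNReal.ofReal_ne_top))) (.inr ENNReal.coe_ne_top)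
    rw [mul_zero, add_zero] at h0
    exact ge_of_tendsto' h0 fun n => H _ (ENNReal.inv_ne_zero.2 (ENNReal.natCast_ne_top n))
  intro ε hε
  obtain ⟨t, μ, ht, hdisj, hcover, hμ, hsum⟩ := exists_partition_tsum_le_sInf
    (𝒮 := {μ : Measure X | IsFiniteMeasure μ ∧ IsMassBound T μ}) ⟨μ₀, hμ₀, hTμ₀⟩
    (measure_ne_top (mass T) univ) hε
  have hΦ : ∀ ν : Measure X, IsMassBound T ν →
      ∀ g : LipB X, ‖slice T π g‖ₑ ≤ P * ∫⁻ x, ‖(g : X → ℝ) x‖ₑ ∂ν := fun ν hν g => by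
    rw [← hPc]; exact hν g π
  have key := enorm_le_tsum_of_forall_cut (slice T π) μ₀ P (hΦ μ₀ hTμ₀) f ht hdisj hcover
    (fun k => P • μ k) (fun k K hK _ => by
      have := (hμ k).1
      refine ⟨fun n => P * ∫⁻ x, ‖(cut f K n : X → ℝ) x‖ₑ ∂μ k, ?_, fun n => hΦ _ (hμ k).2 _⟩
      rw [Measure.restrict_smul, lintegral_smul_measure]
      exact ENNReal.Tendsto.const_mul (tendsto_lintegral_cut f hK (μ k)) (.inr ENNReal.coe_ne_top))
  have hq : ∑' k, ∫⁻ x in t k, ‖(f : X → ℝ) x‖ₑ ∂(P • μ k)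
      = P * ∫⁻ x, ‖(f : X → ℝ) x‖ₑ ∂(Measure.sum fun k => (μ k).restrict (t k)) := by
    rw [lintegral_sum_measure, ← ENNReal.tsum_mul_left]
    refine tsum_congr fun k => ?_
    rw [Measure.restrict_smul, lintegral_smul_measure]
    rfl
  rw [hq] at key
  refine key.trans ?_
  gcongr
  refine lintegral_le_lintegral_add ?_ ?_ fun x => ?_
  · have hσt : mass T = Measure.sum fun k => (mass T).restrict (t k) := by
      rw [← Measure.restrict_iUnion hdisj ht, hcover, Measure.restrict_univ]
    rw [hσt]
    have := fun k => (hμ k).1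
    refine Measure.le_iff.2 fun s hs => ?_
    rw [Measure.sum_apply _ hs, Measure.sum_apply _ hs]
    exact ENNReal.tsum_le_tsum fun k => Measure.restrict_mono_measure (mass_le (hμ k).2) _ s
  · rw [Measure.sum_apply _ MeasurableSet.univ]
    simp only [Measure.restrict_apply_univ]
    exact hsum
  · rw [Real.enorm_eq_ofReal_abs]
    exact ENNReal.ofReal_le_ofReal (hM x)

end Mass

section Locality

variable {X : Type*} [MetricSpace X] {m : ℕ}

/-! ### Locality on closed sets -/

theorem lipschitzWith_clamp (c : ℝ) : LipschitzWith 1 fun t : ℝ => max (-c) (min t c) :=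
  (LipschitzWith.id.min_const c).const_max (-c)

/-- Truncation of a Lipschitz function to the interval `[-c, c]`. -/
def clamp (c : ℝ) (p : Lip X) : Lip X :=
  ⟨fun x => max (-c) (min ((p : X → ℝ) x) c), 1 * lipConst (p : X → ℝ),
    (lipschitzWith_clamp c).comp (lipschitzWith_lipConst p.2)⟩

theorem clamp_eq_self {c : ℝ} {p : Lip X} {x : X} (h : |(p : X → ℝ) x| ≤ c) :
    (clamp c p : X → ℝ) x = (p : X → ℝ) x := by
  change max (-c) (min ((p : X → ℝ) x) c) = _
  rw [min_eq_left (abs_le.1 h).2, max_eq_right (abs_le.1 h).1]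

theorem lipConst_clamp_le (c : ℝ) (p : Lip X) :
    lipConst (clamp c p : X → ℝ) ≤ lipConst (p : X → ℝ) := by
  refine lipConst_le ?_
  have h := (lipschitzWith_clamp c).comp (lipschitzWith_lipConst p.2)
  rwa [one_mul] at h

theorem tendsto_clamp_zero (p : Lip X) (x : X) :
    Tendsto (fun j : ℕ => (clamp (1 / ((j : ℝ) + 1)) p : X → ℝ) x) atTop (𝓝 0) := by
  have h0 := tendsto_one_div_add_atTop_nhds_zero_nat (𝕜 := ℝ)
  refine tendsto_of_tendsto_of_tendsto_of_le_of_le (by simpa using h0.neg) h0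
    (fun j => le_max_left _ _) fun j => max_le ?_ (min_le_right _ _)
  have : (0 : ℝ) < 1 / ((j : ℝ) + 1) := Nat.one_div_pos_of_nat
  linarith

variable [MeasurableSpace X] [BorelSpace X]

/-- Near a closed set where `πᵢ` vanishes, `πᵢ` is small, so by locality it may be replaced by its
truncation to `[-c, c]`. -/
theorem IsLocalFunctional.eventually_apply_cut_eq {T : Functional X m} (hT : IsLocalFunctional T)
    (f : LipB X) (π : Fin m → Lip X) (i : Fin m) {K : Set X}
    (hK : ∀ x ∈ K, (π i : X → ℝ) x = 0) {c : ℝ} (hc : 0 < c) :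
    ∀ᶠ n in atTop, T (cut f K n) π = T (cut f K n) (Function.update π i (clamp c (π i))) := by
  have h0 := (tendsto_one_div_add_atTop_nhds_zero_nat (𝕜 := ℝ)).const_mul
    (lipConst (π i : X → ℝ) : ℝ)
  rw [mul_zero] at h0
  filter_upwards [h0.eventually (gt_mem_nhds hc)] with n hn
  have hpi : π = Function.update π i (π i) := (Function.update_eq_self i π).symm
  rw [← sub_eq_zero]
  conv_lhs => rw [hpi]
  rw [Function.update_idem, Function.update_self, ← MultilinearMap.map_update_sub]
  -- The coordinate `i` alone covers the support, so the other sets of the cover may be empty.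
  refine hT _ _ (fun k => if k = i then {x | |(π i : X → ℝ) x| ≤ c} else ∅) (fun k => ?_) ?_
    fun k => ?_
  · have hmeas : MeasurableSet {x | |(π i : X → ℝ) x| ≤ c} :=
      (isClosed_le (Lip.continuous (π i)).abs continuous_const).measurableSet
    by_cases hk : k = i <;> simp [hk, hmeas]
  · intro x hx
    refine mem_iUnion.2 ⟨i, ?_⟩
    rw [if_pos rfl]
    have hx' : cutoff K n x ≠ 0 := right_ne_zero_of_mul hx
    have hthick : x ∈ Metric.thickening (1 / ((n : ℝ) + 1)) K := by
      by_contra hnot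
      refine hx' ?_
      rw [cutoff, thickenedIndicator_zero _ _ hnot]
      rfl
    obtain ⟨z, hzK, hz⟩ := Metric.mem_thickening_iff.1 hthick
    have h := (lipschitzWith_lipConst (π i).2).dist_le_mul x z
    rw [Real.dist_eq, hK z hzK, sub_zero] at h
    exact h.trans ((mul_le_mul_of_nonneg_left hz.le (NNReal.coe_nonneg _)).trans hn.le)
  · by_cases hk : k = i
    · subst hk
      refine ⟨0, fun x hx => ?_⟩
      rw [if_pos rfl] at hx
      rw [Function.update_self]
      change (π k : X → ℝ) x - (clamp c (π k) : X → ℝ) x = 0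
      rw [clamp_eq_self hx, sub_self]
    · exact ⟨0, fun x hx => by simp [hk] at hx⟩

/-- If `πᵢ` vanishes on a closed set `K`, then `T(·, π)` tends to `0` along the cutoffs near `K`.
The truncations of `πᵢ` tend to `0`, and the mass bound makes the resulting convergence uniform
along the cutoffs of `f`. -/
theorem IsMetricCurrent.tendsto_apply_cut_zero {T : Functional X m} (hT : IsMetricCurrent T)
    (f : LipB X) (π : Fin m → Lip X) (i : Fin m) {K : Set X} (hKc : IsClosed K)
    (hK : ∀ x ∈ K, (π i : X → ℝ) x = 0) :
    Tendsto (fun n => ‖T (cut f K n) π‖ₑ) atTop (𝓝 0) := by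
  obtain ⟨μ, _, hμ⟩ := hT.finite_mass
  set P : ℝ≥0 := ∏ i, lipConst (π i : X → ℝ) with hP
  let a : ℕ → ℝ≥0∞ := fun n =>
    P * ∫⁻ x, ‖(cut f K n : X → ℝ) x - K.indicator (f : X → ℝ) x‖ₑ ∂μ
  have ha : Tendsto a atTop (𝓝 0) := by
    have h := ENNReal.Tendsto.const_mul (a := (P : ℝ≥0∞))
      (tendsto_lintegral_cut_sub_indicator f hKc μ) (.inr ENNReal.coe_ne_top)
    rwa [mul_zero] at h
  let σ : ℕ → Fin m → Lip X := fun j =>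
    Function.update π i (clamp (1 / ((j : ℝ) + 1)) (π i))
  have hσP : ∀ j k, lipConst (σ j k : X → ℝ) ≤ lipConst (π k : X → ℝ) := by
    intro j k
    by_cases hk : k = i
    · subst hk
      simpa [σ] using lipConst_clamp_le _ (π k)
    · simp [σ, hk]
  have hdiff : ∀ j n N, ‖T (cut f K n) (σ j)‖ₑ ≤ ‖T (cut f K N) (σ j)‖ₑ + (a n + a N) := by
    intro j n N
    have hdec : T (cut f K n) (σ j)
        = T (cut f K N) (σ j) + T (cut f K n - cut f K N) (σ j) := by simp
    rw [hdec]
    refine (enorm_add_le _ _).trans (add_le_add_right ((hμ _ _).trans ?_) _)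
    have hPc : (∏ k, (lipConst (σ j k : X → ℝ) : ℝ≥0∞)) ≤ P := by
      rw [hP]; push_cast
      exact Finset.prod_le_prod' fun k _ => ENNReal.coe_le_coe.2 (hσP j k)
    refine (mul_le_mul_left hPc _).trans ?_
    rw [← mul_add, ← lintegral_add_left]
    · gcongr with x
      have : ((cut f K n - cut f K N : LipB X) : X → ℝ) x
          = ((cut f K n : X → ℝ) x - K.indicator (f : X → ℝ) x)
            - ((cut f K N : X → ℝ) x - K.indicator (f : X → ℝ) x) := by simp
      rw [this]
      exact enorm_sub_le
    · exact ((LipB.measurable _).sub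
        ((LipB.measurable f).indicator hKc.measurableSet)).enorm
  have hσ0 : ∀ N, Tendsto (fun j => ‖T (cut f K N) (σ j)‖ₑ) atTop (𝓝 0) := by
    intro N
    have h := hT.continuity (cut f K N) (Function.update π i 0) σ
      ⟨∑ k, lipConst (π k : X → ℝ), fun j k => (hσP j k).trans
        (Finset.single_le_sum (f := fun k => lipConst (π k : X → ℝ))
          (fun _ _ => zero_le) (Finset.mem_univ k))⟩ (fun k x => ?_)
    · rw [MultilinearMap.map_coord_zero (T (cut f K N)) i (by simp)] at h
      simpa using h.enorm
    · by_cases hk : k = i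
      · subst hk
        simpa [σ] using tendsto_clamp_zero (π k) x
      · simp [σ, hk]
  rw [ENNReal.tendsto_nhds_zero]
  intro ε hε
  have hε3 : 0 < ε / 3 := ENNReal.div_pos hε.ne' (by simp)
  have haε := (ENNReal.tendsto_nhds_zero.1 ha) _ hε3
  -- `N` controls the distance to the later cutoffs for all `j` at once. Only then is `j` chosen,
  -- to make the truncated value at `N` small.
  obtain ⟨N, hN⟩ := haε.exists
  obtain ⟨j, hj⟩ := ((ENNReal.tendsto_nhds_zero.1 (hσ0 N)) _ hε3).exists
  filter_upwards [haε, hT.locality.eventually_apply_cut_eq f π i hK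
    (c := 1 / ((j : ℝ) + 1)) Nat.one_div_pos_of_nat] with n hn hloc
  rw [hloc]
  calc ‖T (cut f K n) (σ j)‖ₑ ≤ ‖T (cut f K N) (σ j)‖ₑ + (a n + a N) := hdiff j n N
    _ ≤ ε / 3 + (ε / 3 + ε / 3) := by gcongr
    _ = ε := by rw [← add_assoc, ENNReal.add_thirds]

/-- In the limit along the cutoffs near a closed set `K`, `T(·, π)` depends only on the restrictions
of the `πᵢ` to `K`. The `πᵢ` are exchanged one at a time. -/
theorem IsMetricCurrent.tendsto_apply_cut_sub {T : Functional X m} (hT : IsMetricCurrent T)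
    (f : LipB X) (π π' : Fin m → Lip X) {K : Set X} (hKc : IsClosed K)
    (hK : ∀ i, EqOn (π i : X → ℝ) (π' i : X → ℝ) K) :
    Tendsto (fun n => ‖T (cut f K n) π - T (cut f K n) π'‖ₑ) atTop (𝓝 0) := by
  suffices H : ∀ s : Finset (Fin m), Tendsto
      (fun n => ‖T (cut f K n) π - T (cut f K n) (s.piecewise π' π)‖ₑ) atTop (𝓝 0) by
    simpa using H Finset.univ
  intro s
  induction s using Finset.induction_on with
  | empty => simp
  | insert i s hi ih =>
    let ρ : Fin m → Lip X := s.piecewise π' π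
    have h := hT.tendsto_apply_cut_zero f (Function.update ρ i (π i - π' i)) i hKc fun x hx => by
      rw [Function.update_self]
      exact sub_eq_zero.2 (hK i hx)
    have hsum := ih.add h
    rw [add_zero] at hsum
    refine tendsto_of_tendsto_of_tendsto_of_le_of_le tendsto_const_nhds hsum
      (fun _ => zero_le) fun n => ?_
    have hρ : Function.update ρ i (π i) = ρ := by
      have : ρ i = π i := by simp [ρ, hi]
      rw [← this, Function.update_eq_self]
    have hdec : T (cut f K n) π - T (cut f K n) ((insert i s).piecewise π' π)
        = (T (cut f K n) π - T (cut f K n) ρ)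
          + T (cut f K n) (Function.update ρ i (π i - π' i)) := by
      rw [MultilinearMap.map_update_sub, hρ, Finset.piecewise_insert]
      ring
    change ‖_‖ₑ ≤ _
    rw [hdec]
    exact enorm_add_le _ _

/-- If the restrictions of the `πᵢ` to `K` are `Lᵢ`-Lipschitz, then `T(·, π)` is bounded by
`∏ Lᵢ` times the mass near `K`: extend the restrictions to `X` with the same constants. -/
theorem IsMetricCurrent.exists_tendsto_enorm_apply_cut_le {T : Functional X m}
    (hT : IsMetricCurrent T) {μ : Measure X} [IsFiniteMeasure μ] (hμ : IsMassBound T μ)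
    (f : LipB X) (π : Fin m → Lip X) {K : Set X} (hKc : IsClosed K) (L : Fin m → ℝ≥0)
    (hL : ∀ i, LipschitzOnWith (L i) (π i : X → ℝ) K) :
    ∃ u : ℕ → ℝ≥0∞,
      Tendsto u atTop (𝓝 ((∏ i, L i : ℝ≥0) * ∫⁻ x in K, ‖(f : X → ℝ) x‖ₑ ∂μ)) ∧
      ∀ n, ‖T (cut f K n) π‖ₑ ≤ u n := by
  choose ρ hρ hρK using fun i => (hL i).extend_real
  let π' : Fin m → Lip X := fun i => ⟨ρ i, L i, hρ i⟩
  refine ⟨fun n => (∏ i, L i : ℝ≥0) * ∫⁻ x, ‖(cut f K n : X → ℝ) x‖ₑ ∂μ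
    + ‖T (cut f K n) π - T (cut f K n) π'‖ₑ, ?_, fun n => ?_⟩
  · have h := (ENNReal.Tendsto.const_mul (a := ((∏ i, L i : ℝ≥0) : ℝ≥0∞))
      (tendsto_lintegral_cut f hKc μ) (.inr ENNReal.coe_ne_top)).add
      (hT.tendsto_apply_cut_sub f π π' hKc hρK)
    rwa [add_zero] at h
  · have hdec : T (cut f K n) π
        = T (cut f K n) π' + (T (cut f K n) π - T (cut f K n) π') := by ring
    conv_lhs => rw [hdec]
    refine (enorm_add_le _ _).trans (add_le_add_left ((hμ _ _).trans ?_) _)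
    gcongr
    push_cast
    exact Finset.prod_le_prod' fun i _ => ENNReal.coe_le_coe.2 (lipConst_le (hρ i))

end Locality

section PointwiseLipschitz

variable {X : Type*} [MetricSpace X]

/-! ### The pointwise Lipschitz constant -/

theorem lipAtScale_mono (f : X → ℝ) (x : X) : Monotone fun r : ℝ => lipAtScale f r x :=
  fun _ _ h => iSup₂_mono' fun s hs => ⟨s, ⟨hs.1, hs.2.trans_le h⟩, le_rfl⟩

theorem ptLip_eq_iInf_nat (f : X → ℝ) (x : X) :
    ptLip f x = ⨅ n : ℕ, lipAtScale f (1 / ((n : ℝ) + 1)) x := by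
  refine le_antisymm (le_iInf fun n => iInf₂_le _ Nat.one_div_pos_of_nat)
    (le_iInf₂ fun r hr => ?_)
  obtain ⟨n, hn⟩ := exists_nat_one_div_lt (mem_Ioi.1 hr)
  exact (iInf_le _ n).trans (lipAtScale_mono f x hn.le)

theorem ptLip_le_lipConst {f : X → ℝ} (hf : f ∈ Lip X) (x : X) : ptLip f x ≤ lipConst f := by
  refine (iInf₂_le 1 one_pos).trans (iSup₂_le fun s hs => iSup₂_le fun y hy => ?_)
  refine ENNReal.div_le_of_le_mul ?_
  rw [← edist_eq_enorm_sub]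
  refine ((lipschitzWith_lipConst hf).edist_le_mul x y).trans ?_
  gcongr
  rw [edist_dist, dist_comm]
  exact ENNReal.ofReal_le_ofReal (Metric.mem_ball.1 hy).le

/-- Strict bounds for `L_r f(x)` are witnessed by a single pair `(s, y)` and hold for nearby
points with the same pair, so `L_r f` is lower semicontinuous. -/
theorem lowerSemicontinuous_lipAtScale {f : X → ℝ} (hf : Continuous f) (r : ℝ) :
    LowerSemicontinuous (lipAtScale f r) := by
  rw [lowerSemicontinuous_iff_isOpen_preimage]
  intro c
  have : lipAtScale f r ⁻¹' Ioi c = ⋃ s ∈ Ioo (0 : ℝ) r, ⋃ y : X,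
      Metric.ball y s ∩ {x | c < ‖f x - f y‖ₑ / ENNReal.ofReal s} := by
    ext x
    simp only [mem_preimage, mem_Ioi, lipAtScale, lt_iSup_iff, mem_iUnion, mem_inter_iff,
      mem_ofPred_eq, Metric.mem_ball, exists_prop]
    simp only [dist_comm]
  rw [this]
  refine isOpen_biUnion fun s hs => isOpen_iUnion fun y => Metric.isOpen_ball.inter ?_
  have hs0 : ENNReal.ofReal s ≠ 0 := (ENNReal.ofReal_pos.2 hs.1).ne'
  exact isOpen_lt continuous_const
    ((ENNReal.continuous_div_const _ hs0).comp (hf.sub continuous_const).enorm)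

theorem dist_le_of_lipAtScale_lt {f : X → ℝ} {r : ℝ} {x y : X} {L : ℝ≥0}
    (h : lipAtScale f r x < L) (hxy : dist x y < r) : dist (f x) (f y) ≤ L * dist x y := by
  have hs : ∀ s ∈ Ioo (dist x y) r, dist (f x) (f y) ≤ L * s := by
    intro s hs
    have hs0 : 0 < s := dist_nonneg.trans_lt hs.1
    have h1 : ‖f x - f y‖ₑ / ENNReal.ofReal s ≤ L := by
      refine le_trans ?_ h.le
      refine le_iSup₂_of_le s ⟨hs0, hs.2⟩ (le_iSup₂_of_le y ?_ le_rfl)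
      rw [Metric.mem_ball, dist_comm]
      exact hs.1
    rw [ENNReal.div_le_iff (ENNReal.ofReal_pos.2 hs0).ne' ENNReal.ofReal_ne_top,
      ← edist_eq_enorm_sub, edist_dist, ← ENNReal.ofReal_coe_nnreal,
      ← ENNReal.ofReal_mul (NNReal.coe_nonneg _)] at h1
    exact (ENNReal.ofReal_le_ofReal_iff (by positivity)).1 h1
  have hlim : Tendsto (fun s : ℝ => L * s) (𝓝[>] dist x y) (𝓝 (L * dist x y)) :=
    ((continuous_const_mul (L : ℝ)).tendsto _).mono_left nhdsWithin_le_nhds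
  exact ge_of_tendsto hlim (mem_of_superset (Ioo_mem_nhdsGT hxy) hs)

variable [MeasurableSpace X] [BorelSpace X]

theorem measurable_ptLip {f : X → ℝ} (hf : Continuous f) : Measurable (ptLip f) := by
  rw [funext (ptLip_eq_iInf_nat f)]
  exact Measurable.iInf fun n => (lowerSemicontinuous_lipAtScale hf _).measurable

/-- A Lipschitz function restricts to countably many Borel sets covering `X` with Lipschitz
constants close to its pointwise Lipschitz constant. On each piece the function is `L`-Lipschitz at
distances below some scale `r`, and its values lie in an interval of length `L r`, which gives the
same bound at larger distances. Slicing by values in this way avoids a countable cover by small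
balls, so no separability is needed. -/
theorem exists_cover_lipschitzOnWith (p : Lip X) {ε : ℝ≥0} (hε : 0 < ε) :
    ∃ (A : ℕ × ℕ × ℤ → Set X) (L : ℕ × ℕ × ℤ → ℝ≥0), (∀ q, MeasurableSet (A q)) ∧
      (∀ x, ∃ q, x ∈ A q) ∧ (∀ q, LipschitzOnWith (L q) (p : X → ℝ) (A q)) ∧
      ∀ q, ∀ x ∈ A q, (L q : ℝ≥0∞) ≤ ptLip (p : X → ℝ) x + ε := by
  have hcont := Lip.continuous p
  -- An index `(j, n, k)` records that `Lip p(x) ≥ jε`, that `L = (j + 1)ε` is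
  -- a strict upper bound for `L_r p(x)` with `r = 1 / (n + 1)`, and that `p(x)` lies in the `k`-th
  -- interval of length `δ = L / (n + 1)`.
  let L : ℕ × ℕ × ℤ → ℝ≥0 := fun q => (q.1 + 1) * ε
  have hL : ∀ q, 0 < (L q : ℝ) := fun q => by
    have : 0 < L q := by positivity
    exact_mod_cast this
  let δ : ℕ × ℕ × ℤ → ℝ := fun q => L q * (1 / ((q.2.1 : ℝ) + 1))
  have hδ : ∀ q, 0 < δ q := fun q => mul_pos (hL q) Nat.one_div_pos_of_nat
  let A : ℕ × ℕ × ℤ → Set X := fun q =>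
    ({x | ((q.1 * ε : ℝ≥0) : ℝ≥0∞) ≤ ptLip (p : X → ℝ) x} ∩
      {x | lipAtScale (p : X → ℝ) (1 / ((q.2.1 : ℝ) + 1)) x < L q}) ∩
      (p : X → ℝ) ⁻¹' Ico (q.2.2 * δ q) ((q.2.2 + 1) * δ q)
  refine ⟨A, L, fun q => ?_, fun x => ?_, fun q => ?_, fun q x hx => ?_⟩
  · exact ((measurableSet_le measurable_const (measurable_ptLip hcont)).inter
      (measurableSet_lt (lowerSemicontinuous_lipAtScale hcont _).measurable
        measurable_const)).inter (hcont.measurable measurableSet_Ico)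
  · have hfin : ptLip (p : X → ℝ) x ≠ ∞ :=
      ne_top_of_le_ne_top ENNReal.coe_ne_top (ptLip_le_lipConst p.2 x)
    lift ptLip (p : X → ℝ) x to ℝ≥0 using hfin with a ha
    let j := ⌊a / ε⌋₊
    have hj1 : j * ε ≤ a := (le_div_iff₀ hε).1 (Nat.floor_le (zero_le))
    have hj2 : a < (j + 1) * ε := (div_lt_iff₀ hε).1 (Nat.lt_floor_add_one _)
    have hlt : ptLip (p : X → ℝ) x < (((j + 1) * ε : ℝ≥0) : ℝ≥0∞) := by
      rw [← ha]; exact_mod_cast hj2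
    rw [ptLip_eq_iInf_nat, iInf_lt_iff] at hlt
    obtain ⟨n, hn⟩ := hlt
    have hd := hδ (j, n, 0)
    refine ⟨(j, n, ⌊(p : X → ℝ) x / δ (j, n, 0)⌋), ⟨?_, hn⟩, ?_, ?_⟩
    · change _ ≤ ptLip (p : X → ℝ) x
      rw [← ha]; exact_mod_cast hj1
    · exact (le_div_iff₀ hd).1 (Int.floor_le _)
    · exact (div_lt_iff₀ hd).1 (Int.lt_floor_add_one _)
  · refine LipschitzOnWith.of_dist_le_mul fun x hx y hy => ?_
    rcases lt_or_ge (dist x y) (1 / ((q.2.1 : ℝ) + 1)) with h | h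
    · exact dist_le_of_lipAtScale_lt hx.1.2 h
    · refine le_trans ?_ (mul_le_mul_of_nonneg_left h (hL q).le)
      obtain ⟨hx1, hx2⟩ := hx.2
      obtain ⟨hy1, hy2⟩ := hy.2
      change _ ≤ δ q
      rw [Real.dist_eq, abs_le]
      constructor <;> linarith
  · have h1 : ((q.1 * ε : ℝ≥0) : ℝ≥0∞) ≤ ptLip (p : X → ℝ) x := hx.1.1
    calc (L q : ℝ≥0∞) = ((q.1 * ε : ℝ≥0) : ℝ≥0∞) + ε := by
          rw [← ENNReal.coe_add]; congr 1; simp only [L]; ring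
      _ ≤ _ := by gcongr

/-- The version of `exists_cover_lipschitzOnWith` for finitely many functions at once, with
disjoint pieces. -/
theorem exists_partition_lipschitzOnWith {m : ℕ} (π : Fin m → Lip X) {ε : ℝ≥0} (hε : 0 < ε) :
    ∃ (B : ℕ → Set X) (L : ℕ → Fin m → ℝ≥0), (∀ k, MeasurableSet (B k)) ∧
      Pairwise (Function.onFun Disjoint B) ∧ ⋃ k, B k = univ ∧
      (∀ k i, LipschitzOnWith (L k i) (π i : X → ℝ) (B k)) ∧
      ∀ k i, ∀ x ∈ B k, (L k i : ℝ≥0∞) ≤ ptLip (π i : X → ℝ) x + ε := by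
  choose A L hA hcover hL hLe using fun i => exists_cover_lipschitzOnWith (π i) hε
  obtain ⟨e, he⟩ := exists_surjective_nat (Fin m → ℕ × ℕ × ℤ)
  have hsub := fun k => disjointed_subset (fun k => ⋂ i, A i (e k i)) k
  refine ⟨disjointed fun k => ⋂ i, A i (e k i), fun k i => L i (e k i),
    fun k => MeasurableSet.disjointed (fun k => MeasurableSet.iInter fun i => hA i _) k,
    disjoint_disjointed _, ?_, fun k i => ?_, fun k i x hx => ?_⟩
  · rw [iUnion_disjointed, eq_univ_iff_forall]
    intro x
    choose q hq using fun i => hcover i x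
    obtain ⟨k, rfl⟩ := he q
    exact mem_iUnion.2 ⟨k, mem_iInter.2 hq⟩
  · exact (hL i (e k i)).mono ((hsub k).trans (iInter_subset _ i))
  · exact hLe i _ x (mem_iInter.1 (hsub k hx) i)

/-! ### The pointwise mass estimate -/

/-- The mass bound holds with the global Lipschitz constants replaced by the pointwise ones. -/
theorem IsMetricCurrent.enorm_apply_le {m : ℕ} {T : Functional X m} (hT : IsMetricCurrent T)
    {μ : Measure X} [IsFiniteMeasure μ] (hμ : IsMassBound T μ) (f : LipB X)
    (π : Fin m → Lip X) :
    ‖T f π‖ₑ ≤ ∫⁻ x, ‖(f : X → ℝ) x‖ₑ * ∏ i, ptLip (π i : X → ℝ) x ∂μ := by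
  have hmeas : ∀ i, Measurable (ptLip (π i : X → ℝ)) := fun i =>
    measurable_ptLip (Lip.continuous (π i))
  have hε : ∀ ε : ℝ≥0, 0 < ε → ‖T f π‖ₑ ≤
      ∫⁻ x, ‖(f : X → ℝ) x‖ₑ * ∏ i, (ptLip (π i : X → ℝ) x + ε) ∂μ := by
    intro ε hε
    obtain ⟨B, L, hB, hdisj, hcover, hL, hLe⟩ := exists_partition_lipschitzOnWith π hε
    have key := enorm_le_tsum_of_forall_cut (slice T π) μ (∏ i, lipConst (π i : X → ℝ))
      (fun g => by push_cast; exact hμ g π) f hB hdisj hcover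
      (fun k => (∏ i, L k i : ℝ≥0) • μ) (fun k K hK hKB => by
        rw [Measure.restrict_smul, lintegral_smul_measure]
        exact hT.exists_tendsto_enorm_apply_cut_le hμ f π hK (L k)
          fun i => (hL k i).mono hKB)
    refine key.trans ?_
    conv_rhs => rw [← setLIntegral_univ, ← hcover, lintegral_iUnion hB hdisj]
    refine ENNReal.tsum_le_tsum fun k => ?_
    rw [Measure.restrict_smul, lintegral_smul_measure]
    change ((∏ i, L k i : ℝ≥0) : ℝ≥0∞) * _ ≤ _
    rw [← lintegral_const_mul _ (LipB.measurable f).enorm]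
    refine setLIntegral_mono' (hB k) fun x hx => ?_
    rw [mul_comm]
    gcongr
    push_cast
    exact Finset.prod_le_prod' fun i _ => hLe k i x hx
  obtain ⟨M, hM⟩ := f.2.2
  have hpt : ∀ i x, ptLip (π i : X → ℝ) x ≠ ∞ := fun i x =>
    ne_top_of_le_ne_top ENNReal.coe_ne_top (ptLip_le_lipConst (π i).2 x)
  have hlim : Tendsto (fun n : ℕ => ∫⁻ x, ‖(f : X → ℝ) x‖ₑ *
      ∏ i, (ptLip (π i : X → ℝ) x + ((1 / ((n : ℝ≥0) + 1) : ℝ≥0) : ℝ≥0∞)) ∂μ) atTop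
      (𝓝 (∫⁻ x, ‖(f : X → ℝ) x‖ₑ * ∏ i, ptLip (π i : X → ℝ) x ∂μ)) := by
    refine tendsto_lintegral_of_dominated_convergence
      (fun _ => ENNReal.ofReal M * ∏ i, ((lipConst (π i : X → ℝ) : ℝ≥0∞) + 1))
      (fun n => (LipB.measurable f).enorm.mul
        (Finset.measurable_fun_prod _ fun i _ => (hmeas i).add_const _))
      (fun n => ae_of_all _ fun x => ?_) ?_ (ae_of_all _ fun x => ?_)
    · refine mul_le_mul' ((Real.enorm_eq_ofReal_abs _).trans_le
        (ENNReal.ofReal_le_ofReal (hM x))) (Finset.prod_le_prod' fun i _ =>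
        add_le_add (ptLip_le_lipConst (π i).2 x) ?_)
      have : (1 / ((n : ℝ≥0) + 1) : ℝ≥0) ≤ 1 := by
        rw [div_le_one (by positivity)]
        exact le_add_of_nonneg_left zero_le
      exact_mod_cast this
    · rw [lintegral_const]
      refine ENNReal.mul_ne_top (ENNReal.mul_ne_top ENNReal.ofReal_ne_top
        (ENNReal.prod_ne_top fun i _ => ?_)) (measure_ne_top _ _)
      exact ENNReal.add_ne_top.2 ⟨ENNReal.coe_ne_top, ENNReal.one_ne_top⟩
    · have h0 : Tendsto (fun n : ℕ => ((1 / ((n : ℝ≥0) + 1) : ℝ≥0) : ℝ≥0∞)) atTop (𝓝 0) :=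
        ENNReal.tendsto_coe.2 (tendsto_one_div_add_atTop_nhds_zero_nat (𝕜 := ℝ≥0))
      refine ENNReal.Tendsto.const_mul ?_ (.inr enorm_ne_top)
      refine ENNReal.tendsto_finsetProd_of_ne_top _ (fun i _ => ?_) fun i _ => hpt i x
      simpa using h0.const_add (ptLip (π i : X → ℝ) x)
  exact ge_of_tendsto' hlim fun n => hε _ (by positivity)

/-- The pointwise mass estimate for the mass measure. -/
theorem Current.abs_apply_le {m : ℕ} (T : Current X m) (f : LipB X) (π : Fin m → Lip X) :
    ((T.1 f π : ℝ) : EReal).abs ≤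
      ∫⁻ x, ‖(f : X → ℝ) x‖ₑ * ∏ i, ptLip (π i : X → ℝ) x ∂(mass T.1) := by
  have hT : IsMetricCurrent T.1 := T.2
  have := hT.isFiniteMeasure_mass
  rw [EReal.abs_def, ← Real.enorm_eq_ofReal_abs]
  exact hT.enorm_apply_le hT.isMassBound_mass f π

end PointwiseLipschitz

end MetricCurrents

theorem proposition2p6 {X : Type*} [MetricSpace X] [CompleteSpace X] [MeasurableSpace X]
    [BorelSpace X] (m : ℕ) (f : MetricCurrents.LipB X) (π : Fin m → MetricCurrents.Lip X) :
    MetricCurrents.IsUpperNorm (MetricCurrents.formCochain f π)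
      (fun x => ‖(f : X → ℝ) x‖ₑ * ∏ i, MetricCurrents.ptLip (π i : X → ℝ) x) ∧
    MetricCurrents.IsUpperGradient (MetricCurrents.formCochain f π) Set.univ
      (fun x => MetricCurrents.ptLip (f : X → ℝ) x *
        ∏ i, MetricCurrents.ptLip (π i : X → ℝ) x) := by
  have hprod : Measurable fun x => ∏ i, MetricCurrents.ptLip (π i : X → ℝ) x :=
    Finset.measurable_fun_prod _ fun i _ =>
      MetricCurrents.measurable_ptLip (MetricCurrents.Lip.continuous (π i))
  refine ⟨⟨(MetricCurrents.LipB.measurable f).enorm.mul hprod, fun T => ?_⟩,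
    ⟨(MetricCurrents.measurable_ptLip (MetricCurrents.LipB.continuous f)).mul hprod,
      fun T S _ hS => ?_⟩⟩
  · exact MetricCurrents.Current.abs_apply_le (T : MetricCurrents.Current X m) f π
  · change ((((T : MetricCurrents.Current X m).1 f π : ℝ) : EReal)).abs ≤ _
    rw [← hS, MetricCurrents.boundary_apply]
    refine (MetricCurrents.Current.abs_apply_le S _ _).trans_eq (lintegral_congr fun x => ?_)
    rw [Fin.prod_univ_succ]
    simp [MetricCurrents.LipB.one, MetricCurrents.LipB.toLip]
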